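/- Let $\mathrm{GL}(\infty)$ be the group of invertible infinite matrices (rows and columns indexed by $1,2,3,\dots$) over $\mathbb Z[t,t^{-1}]$ that differ from the identity matrix in only finitely many entries. Let $v=(1,t,t^2,\dots)^{\mathrm T}$ and $u=(1,1,1,\dots)^{\mathrm T}$, and for every integer $n\ge 0$ let $$G[n]=\left\{\begin{pmatrix}1_n&0\\0&X\end{pmatrix}\;:\;X\in\mathrm{GL}(\infty),\ v^{\mathrm T}X=v^{\mathrm T},\ Xu=u\right\}.$$ For integers $k,j\ge 0$ let $$\Theta_j[k]=\begin{pmatrix}1_k&0&0&0\\0&V_j&t^j1_j&0\\0&1_j&0&0\\0&0&0&1_\infty\end{pmatrix},$$ where $V_j$ is the $j\times j$ matrix each of whose rows is $(1-t)\,(1,t,\dots,t^{j-1})$. (1) For all $n,k,m\ge 0$ and all $p,q\in\mathrm{GL}(\infty)$, the double coset $G[n]\,p\,\Theta_j[k]\,q\,G[m]$ is the same for all sufficiently large $j$ (how large may depend on $n,k,m,p,q$), and this eventual value depends only on the double cosets $\mathfrak p=G[n]\,p\,G[k]$ and $\mathfrak q=G[k]\,q\,G[m]$. It therefore defines an operation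 $$\star_t\colon\ G[n]\backslash\mathrm{GL}(\infty)/G[k]\times G[k]\backslash\mathrm{GL}(\infty)/G[m]\to G[n]\backslash\mathrm{GL}(\infty)/G[m].$$ (2) The operation is associative: $(\mathfrak a\star_t\mathfrak b)\star_t\mathfrak c=\mathfrak a\star_t(\mathfrak b\star_t\mathfrak c)$ for all $n,k,l,m\ge 0$ and all $\mathfrak a\in G[n]\backslash\mathrm{GL}(\infty)/G[k]$, $\mathfrak b\in G[k]\backslash\mathrm{GL}(\infty)/G[l]$, $\mathfrak c\in G[l]\backslash\mathrm{GL}(\infty)/G[m]$. (3) Setting $t=1$ recovers the usual product. Precisely, let $\mathrm{GL}(\infty,\mathbb Z)$ be the corresponding group over $\mathbb Z$, let $G_1[n]\subset\mathrm{GL}(\infty,\mathbb Z)$ be the subgroup of the matrices $1_n\oplus X$ with $X\in\mathrm{GL}(\infty,\mathbb Z)$, $u^{\mathrm T}X=u^{\mathrm T}$ and $Xu=u$, and let $\theta_j[k]$ be the permutation matrix $$\begin{pmatrix}1_k&0&0&0\\0&0&1_j&0\\0&1_j&0&0\\0&0&0&1_\infty\end{pmatrix}.$$ Then the double coset $G_1[n]\,p\,\theta_j[k]\,q\,G_1[m]$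 is the same for all sufficiently large $j$, its eventual value depends only on $G_1[n]\,p\,G_1[k]$ and $G_1[k]\,q\,G_1[m]$, and the resulting (usual) operation $\circ$ is associative. The homomorphism $\mathrm{GL}(\infty)\to\mathrm{GL}(\infty,\mathbb Z)$ that sets $t=1$ in every entry maps $\Theta_j[k]$ to $\theta_j[k]$ and $G[n]$ into $G_1[n]$, and the maps it induces on double cosets carry $\mathfrak p\star_t\mathfrak q$ to the product under $\circ$ of the images of $\mathfrak p$ and $\mathfrak q$. -/

import Mathlib

open scoped LaurentPolynomial

/-- The `(i, j)` entry (indices starting at `0`) of the infinite matrix of an automorphism of the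
free module `R^(ℕ)` of finitely supported columns: coordinate `i` of the image of `e_j`. -/
noncomputable def autEntry {R : Type*} [CommRing R] (g : (ℕ →₀ R) ≃ₗ[R] (ℕ →₀ R)) (i j : ℕ) : R :=
  g (Finsupp.single j 1) i

/-- The matrix of `g` differs from the identity matrix in only finitely many entries. -/
def IsFinitary {R : Type*} [CommRing R] (g : (ℕ →₀ R) ≃ₗ[R] (ℕ →₀ R)) : Prop :=
  {a : ℕ × ℕ | autEntry g a.1 a.2 ≠ if a.1 = a.2 then 1 else 0}.Finite

theorem isFinitary_iff {R : Type*} [CommRing R] (g : (ℕ →₀ R) ≃ₗ[R] (ℕ →₀ R)) :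
    IsFinitary g ↔ ∃ N, ∀ j, N ≤ j → g (Finsupp.single j 1) = Finsupp.single j 1 := by
  constructor
  · intro h
    obtain ⟨N, hN⟩ := (h.image Prod.snd).bddAbove
    refine ⟨N + 1, fun j hj => ?_⟩
    ext i
    by_contra hne
    have : j ≤ N := hN ⟨(i, j), by
      simpa [autEntry, Finsupp.single_apply, eq_comm] using hne, rfl⟩
    omega
  · rintro ⟨N, hN⟩
    refine ((Finset.range N).finite_toSet.biUnion (t := fun j =>
      (fun i => (i, j)) '' (((g (Finsupp.single j 1)).support ∪ {j} : Finset ℕ) : Set ℕ))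
      (fun j _ => (Finset.finite_toSet _).image _)).subset ?_
    rintro ⟨i, j⟩ h
    simp only [Set.mem_ofPred_eq, autEntry] at h
    have hj : j < N := by
      by_contra hj
      rw [hN j (not_lt.mp hj)] at h
      exact h (by simp [Finsupp.single_apply, eq_comm])
    refine Set.mem_biUnion (x := j) (by simpa using hj) ⟨i, ?_, rfl⟩
    by_contra hi
    simp only [Finset.coe_union, Finset.coe_singleton, Set.mem_union, Finset.mem_coe,
      Finsupp.mem_support_iff, Set.mem_singleton_iff, not_or, not_not] at hi
    exact h (by rw [hi.1, if_neg hi.2])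

/-- `GL(∞)` over `R`: the invertible infinite matrices that differ from the identity matrix in
only finitely many entries. -/
def GLInf (R : Type*) [CommRing R] : Subgroup ((ℕ →₀ R) ≃ₗ[R] (ℕ →₀ R)) where
  carrier := {g | IsFinitary g}
  one_mem' := (isFinitary_iff _).2 ⟨0, fun _ _ => rfl⟩
  mul_mem' := by
    intro a b ha hb
    obtain ⟨N, hN⟩ := (isFinitary_iff _).1 ha
    obtain ⟨M, hM⟩ := (isFinitary_iff _).1 hb
    refine (isFinitary_iff _).2 ⟨max N M, fun j hj => ?_⟩
    rw [LinearEquiv.mul_apply, hM j (le_trans (le_max_right _ _) hj),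
      hN j (le_trans (le_max_left _ _) hj)]
  inv_mem' := by
    intro a ha
    obtain ⟨N, hN⟩ := (isFinitary_iff _).1 ha
    refine (isFinitary_iff _).2 ⟨N, fun j hj => ?_⟩
    exact (LinearEquiv.symm_apply_eq a).2 (hN j hj).symm

namespace GLInf

/-- The `(i, j)` entry of `g ∈ GL(∞)`; indices start at `0`. -/
noncomputable def entry {R : Type*} [CommRing R] (g : GLInf R) (i j : ℕ) : R :=
  autEntry (g : (ℕ →₀ R) ≃ₗ[R] (ℕ →₀ R)) i j

theorem ext_entry {R : Type*} [CommRing R] {g h : GLInf R}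
    (H : ∀ i j, entry g i j = entry h i j) : g = h := by
  apply Subtype.ext
  apply LinearEquiv.toLinearMap_injective
  refine Finsupp.lhom_ext' fun j => LinearMap.ext_ring ?_
  ext i
  exact H i j

/-- `vᵀ X = vᵀ`. The sums are finite: every column of `X` has finitely many nonzero entries. -/
def FixesRow {R : Type*} [CommRing R] (v : ℕ → R) (X : GLInf R) : Prop :=
  ∀ j, ∑ᶠ i, v i * entry X i j = v j

/-- `X u = u`. The sums are finite: every row of `X` has finitely many nonzero entries. -/
def FixesCol {R : Type*} [CommRing R] (u : ℕ → R) (X : GLInf R) : Prop :=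
  ∀ i, ∑ᶠ j, entry X i j * u j = u i

/-- `g` is the block diagonal matrix `1_n ⊕ X`. -/
def IsBlock {R : Type*} [CommRing R] (n : ℕ) (g X : GLInf R) : Prop :=
  ∀ i j, entry g i j =
    if n ≤ i ∧ n ≤ j then entry X (i - n) (j - n) else if i = j then 1 else 0

theorem fixesRow_iff {R : Type*} [CommRing R] (v : ℕ → R) (X : GLInf R) :
    FixesRow v X ↔ ∀ x, Finsupp.linearCombination R v (X.1 x) = Finsupp.linearCombination R v x := by
  have key : ∀ j, ∑ᶠ i, v i * entry X i j =
      Finsupp.linearCombination R v (X.1 (Finsupp.single j 1)) := by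
    intro j
    rw [Finsupp.linearCombination_apply, Finsupp.sum,
      finsum_eq_sum_of_support_subset (s := (X.1 (Finsupp.single j 1)).support)]
    · exact Finset.sum_congr rfl fun i _ => mul_comm _ _
    · intro i hi
      simp only [Finset.mem_coe, Finsupp.mem_support_iff]
      intro h0
      exact hi (by simp [entry, autEntry, h0])
  constructor
  · intro h x
    have : (Finsupp.linearCombination R v) ∘ₗ X.1.toLinearMap = Finsupp.linearCombination R v := by
      refine Finsupp.lhom_ext' fun j => LinearMap.ext_ring ?_
      simpa [← key j] using h j
    exact LinearMap.congr_fun this x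
  · intro h j
    rw [key, h]
    simp

/-- The truncation of `u` to its first `N` coordinates. -/
noncomputable def trunc {R : Type*} [CommRing R] (u : ℕ → R) (N : ℕ) : ℕ →₀ R :=
  ∑ j ∈ Finset.range N, Finsupp.single j (u j)

theorem trunc_apply {R : Type*} [CommRing R] (u : ℕ → R) (N i : ℕ) :
    trunc u N i = if i < N then u i else 0 := by
  simp [trunc, Finsupp.finsetSum_apply, Finsupp.single_apply]

theorem fixesCol_iff {R : Type*} [CommRing R] (u : ℕ → R) (X : GLInf R) :
    FixesCol u X ↔ ∃ N₀, ∀ N, N₀ ≤ N → X.1 (trunc u N) = trunc u N := by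
  obtain ⟨M, hM⟩ := (isFinitary_iff _).1 X.2
  have key : ∀ i N, M ≤ N → i < N → ∑ᶠ j, entry X i j * u j = X.1 (trunc u N) i := by
    intro i N hN hi
    rw [finsum_eq_sum_of_support_subset (s := Finset.range N), trunc, map_sum,
      Finsupp.finsetSum_apply]
    · refine Finset.sum_congr rfl fun j _ => ?_
      have : Finsupp.single j (u j) = u j • Finsupp.single j (1 : R) := by simp
      rw [this, map_smul, Finsupp.smul_apply, smul_eq_mul, mul_comm]
      rfl
    · intro j hj
      by_contra hjN
      have hjN : N ≤ j := by simpa using hjN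
      apply hj
      change X.1 (Finsupp.single j 1) i * u j = 0
      rw [hM j (hN.trans hjN), Finsupp.single_apply, if_neg (by omega), zero_mul]
  obtain ⟨K, hK⟩ : ∃ K, ∀ j < M, ∀ i, K ≤ i → X.1 (Finsupp.single j 1) i = 0 := by
    refine ⟨((Finset.range M).biUnion fun j => (X.1 (Finsupp.single j 1)).support).sup id + 1,
      fun j hj i hi => ?_⟩
    by_contra hne
    have : i ≤ ((Finset.range M).biUnion fun j => (X.1 (Finsupp.single j 1)).support).sup id :=
      Finset.le_sup (f := id) (Finset.mem_biUnion.2 ⟨j, by simpa using hj, by simpa using hne⟩)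
    omega
  constructor
  · intro h
    refine ⟨max M K, fun N hN => ?_⟩
    have hMN : M ≤ N := (le_max_left _ _).trans hN
    have hKN : K ≤ N := (le_max_right _ _).trans hN
    ext i
    by_cases hi : i < N
    · rw [← key i N hMN hi, h i, trunc_apply, if_pos hi]
    · rw [trunc_apply, if_neg hi, trunc, map_sum, Finsupp.finsetSum_apply]
      refine Finset.sum_eq_zero fun j hj => ?_
      have hj : j < N := by simpa using hj
      have : Finsupp.single j (u j) = u j • Finsupp.single j (1 : R) := by simp
      rw [this, map_smul, Finsupp.smul_apply, smul_eq_mul]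
      by_cases hjM : j < M
      · rw [hK j hjM i (by omega), mul_zero]
      · rw [hM j (by omega), Finsupp.single_apply, if_neg (by omega), mul_zero]
  · rintro ⟨N₀, h⟩ i
    rw [key i (max (max N₀ M) (i + 1)) (by omega) (by omega), h _ (by omega), trunc_apply,
      if_pos (by omega)]

theorem isBlock_iff {R : Type*} [CommRing R] (n : ℕ) (g X : GLInf R) :
    IsBlock n g X ↔ (∀ j < n, g.1 (Finsupp.single j 1) = Finsupp.single j 1) ∧
      ∀ x, g.1 (Finsupp.lmapDomain R R (· + n) x) = Finsupp.lmapDomain R R (· + n) (X.1 x) := by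
  have hinj : Function.Injective (fun i : ℕ => i + n) := fun a b h => by simpa using h
  have hmap : ∀ (x : ℕ →₀ R) (i : ℕ),
      Finsupp.lmapDomain R R (· + n) x i = if n ≤ i then x (i - n) else 0 := by
    intro x i
    split_ifs with hi
    · obtain ⟨k, rfl⟩ := Nat.exists_eq_add_of_le' hi
      rw [Nat.add_sub_cancel]
      exact Finsupp.mapDomain_apply hinj x k
    · refine Finsupp.mapDomain_of_notMem_range x i ?_
      rintro ⟨k, rfl⟩
      exact hi (by simp)
  constructor
  · intro h
    refine ⟨fun j hj => ?_, fun x => ?_⟩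
    · ext i
      have := h i j
      rw [if_neg (by omega)] at this
      simpa [entry, autEntry, Finsupp.single_apply, eq_comm] using this
    · have : g.1.toLinearMap ∘ₗ Finsupp.lmapDomain R R (· + n) =
          Finsupp.lmapDomain R R (· + n) ∘ₗ X.1.toLinearMap := by
        refine Finsupp.lhom_ext' fun j => LinearMap.ext_ring ?_
        ext i
        have h1 := h i (j + n)
        simp only [LinearMap.comp_apply, Finsupp.lsingle_apply, LinearEquiv.coe_coe]
        rw [hmap, Finsupp.lmapDomain_apply, Finsupp.mapDomain_single]
        simp only [entry, autEntry, Nat.add_sub_cancel] at h1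
        rw [h1]
        by_cases hi : n ≤ i
        · rw [if_pos ⟨hi, by omega⟩, if_pos hi]
        · rw [if_neg (by omega), if_neg hi, if_neg (by omega)]
      exact LinearMap.congr_fun this x
  · rintro ⟨h1, h2⟩ i j
    by_cases hj : n ≤ j
    · obtain ⟨k, rfl⟩ := Nat.exists_eq_add_of_le' hj
      have h3 := congrArg (fun y => y i) (h2 (Finsupp.single k 1))
      simp only [] at h3
      rw [hmap, Finsupp.lmapDomain_apply, Finsupp.mapDomain_single] at h3
      simp only [entry, autEntry, Nat.add_sub_cancel]
      rw [h3]
      by_cases hi : n ≤ i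
      · rw [if_pos hi, if_pos ⟨hi, by omega⟩]
      · rw [if_neg hi, if_neg (by omega), if_neg (by omega)]
    · rw [if_neg (by omega)]
      simp only [entry, autEntry]
      rw [h1 j (by omega), Finsupp.single_apply]
      simp [eq_comm]

/-- The subgroup of all block diagonal matrices `1_n ⊕ X` with `X ∈ GL(∞)`, `vᵀ X = vᵀ` and
`X u = u`. -/
def blockStabilizer {R : Type*} [CommRing R] (v u : ℕ → R) (n : ℕ) : Subgroup (GLInf R) where
  carrier := {g | ∃ X : GLInf R, FixesRow v X ∧ FixesCol u X ∧ IsBlock n g X}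
  one_mem' := ⟨1, (fixesRow_iff _ _).2 fun _ => rfl, (fixesCol_iff _ _).2 ⟨0, fun _ _ => rfl⟩,
    (isBlock_iff _ _ _).2 ⟨fun _ _ => rfl, fun _ => rfl⟩⟩
  mul_mem' := by
    rintro a b ⟨X, hX1, hX2, hX3⟩ ⟨Y, hY1, hY2, hY3⟩
    rw [fixesRow_iff] at hX1 hY1
    rw [fixesCol_iff] at hX2 hY2
    rw [isBlock_iff] at hX3 hY3
    obtain ⟨N, hN⟩ := hX2
    obtain ⟨M, hM⟩ := hY2
    refine ⟨X * Y, (fixesRow_iff _ _).2 fun x => ?_,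
      (fixesCol_iff _ _).2 ⟨max N M, fun K hK => ?_⟩,
      (isBlock_iff _ _ _).2 ⟨fun j hj => ?_, fun x => ?_⟩⟩
    · exact (hX1 _).trans (hY1 x)
    · change X.1 (Y.1 _) = _
      rw [hM K (by omega), hN K (by omega)]
    · change a.1 (b.1 _) = _
      rw [hY3.1 j hj, hX3.1 j hj]
    · change a.1 (b.1 _) = _
      rw [hY3.2, hX3.2]
      rfl
  inv_mem' := by
    rintro a ⟨X, hX1, hX2, hX3⟩
    rw [fixesRow_iff] at hX1
    rw [fixesCol_iff] at hX2
    rw [isBlock_iff] at hX3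
    obtain ⟨N, hN⟩ := hX2
    refine ⟨X⁻¹, (fixesRow_iff _ _).2 fun x => ?_,
      (fixesCol_iff _ _).2 ⟨N, fun K hK => ?_⟩,
      (isBlock_iff _ _ _).2 ⟨fun j hj => ?_, fun x => ?_⟩⟩
    · have := hX1 (X.1.symm x)
      rw [LinearEquiv.apply_symm_apply] at this
      exact this.symm
    · exact (LinearEquiv.symm_apply_eq X.1).2 (hN K hK).symm
    · exact (LinearEquiv.symm_apply_eq a.1).2 (hX3.1 j hj).symm
    · refine (LinearEquiv.symm_apply_eq a.1).2 ?_
      rw [hX3.2]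
      change _ = Finsupp.lmapDomain R R (· + n) (X.1 (X.1.symm x))
      rw [LinearEquiv.apply_symm_apply]

/-! The matrix `Θ_j[k]` -/

/-- Column `c` of the block matrix `Θ_j[k]` with parameter `t`. -/
noncomputable def thetaCol {R : Type*} [CommRing R] (t : Rˣ) (k j c : ℕ) : ℕ →₀ R :=
  if c < k then Finsupp.single c 1
  else if c < k + j then
    (∑ i ∈ Finset.range j, Finsupp.single (k + i) ((1 - (t : R)) * (t : R) ^ (c - k))) +
      Finsupp.single (c + j) 1
  else if c < k + 2 * j then Finsupp.single (c - j) ((t : R) ^ j)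
  else Finsupp.single c 1

/-- Column `c` of the inverse of `Θ_j[k]`. -/
noncomputable def thetaInvCol {R : Type*} [CommRing R] (t : Rˣ) (k j c : ℕ) : ℕ →₀ R :=
  if c < k then Finsupp.single c 1
  else if c < k + j then Finsupp.single (c + j) (((t⁻¹ : Rˣ) : R) ^ j)
  else if c < k + 2 * j then
    Finsupp.single (c - j) 1 -
      ∑ i ∈ Finset.range j, Finsupp.single (k + j + i)
        (((t⁻¹ : Rˣ) : R) ^ j * ((1 - (t : R)) * (t : R) ^ (c - j - k)))
  else Finsupp.single c 1

theorem lc_single {R : Type*} [CommRing R] (f : ℕ → ℕ →₀ R) (c : ℕ) (r : R) :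
    Finsupp.linearCombination R f (Finsupp.single c r) = r • f c := by
  simp

theorem theta_mul_inv {R : Type*} [CommRing R] (t : Rˣ) (k j c : ℕ) :
    Finsupp.linearCombination R (thetaCol t k j) (thetaInvCol t k j c) = Finsupp.single c 1 := by
  have ht : ((t⁻¹ : Rˣ) : R) ^ j * (t : R) ^ j = 1 := by
    rw [← mul_pow, Units.inv_mul, one_pow]
  unfold thetaInvCol
  split_ifs with h1 h2 h3
  · rw [lc_single, thetaCol, if_pos h1, one_smul]
  · rw [lc_single, thetaCol, if_neg (by omega), if_neg (by omega), if_pos (by omega),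
      Finsupp.smul_single, smul_eq_mul, ht, Nat.add_sub_cancel]
  · rw [map_sub, map_sum, lc_single, thetaCol, if_neg (by omega), if_pos (by omega), one_smul]
    have : ∀ i ∈ Finset.range j, Finsupp.linearCombination R (thetaCol t k j)
        (Finsupp.single (k + j + i)
          (((t⁻¹ : Rˣ) : R) ^ j * ((1 - (t : R)) * (t : R) ^ (c - j - k)))) =
        Finsupp.single (k + i) ((1 - (t : R)) * (t : R) ^ (c - j - k)) := by
      intro i hi
      have hi : i < j := by simpa using hi
      rw [lc_single, thetaCol, if_neg (by omega), if_neg (by omega), if_pos (by omega),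
        Finsupp.smul_single, smul_eq_mul]
      congr 1
      · omega
      · rw [mul_right_comm, ht, one_mul]
    rw [Finset.sum_congr rfl this, add_sub_cancel_left]
    congr 1
    omega
  · rw [lc_single, thetaCol, if_neg (by omega), if_neg (by omega), if_neg (by omega), one_smul]

theorem theta_inv_mul {R : Type*} [CommRing R] (t : Rˣ) (k j c : ℕ) :
    Finsupp.linearCombination R (thetaInvCol t k j) (thetaCol t k j c) = Finsupp.single c 1 := by
  have ht : (t : R) ^ j * ((t⁻¹ : Rˣ) : R) ^ j = 1 := by
    rw [← mul_pow, Units.mul_inv, one_pow]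
  unfold thetaCol
  split_ifs with h1 h2 h3
  · rw [lc_single, thetaInvCol, if_pos h1, one_smul]
  · rw [map_add, map_sum, lc_single, thetaInvCol, if_neg (by omega), if_neg (by omega),
      if_pos (by omega), one_smul]
    have : ∀ i ∈ Finset.range j, Finsupp.linearCombination R (thetaInvCol t k j)
        (Finsupp.single (k + i) ((1 - (t : R)) * (t : R) ^ (c - k))) =
        Finsupp.single (k + j + i)
          (((t⁻¹ : Rˣ) : R) ^ j * ((1 - (t : R)) * (t : R) ^ (c - k))) := by
      intro i hi
      have hi : i < j := by simpa using hi
      rw [lc_single, thetaInvCol, if_neg (by omega), if_pos (by omega),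
        Finsupp.smul_single, smul_eq_mul]
      congr 1
      · omega
      · rw [mul_comm]
    rw [Finset.sum_congr rfl this, Nat.add_sub_cancel, add_sub_cancel]
  · rw [lc_single, thetaInvCol, if_neg (by omega), if_pos (by omega), Finsupp.smul_single,
      smul_eq_mul, ht]
    congr 1
    omega
  · rw [lc_single, thetaInvCol, if_neg (by omega), if_neg (by omega), if_neg (by omega), one_smul]

/-- The element `Θ_j[k]` of `GL(∞)` with parameter `t`; see `theta_entry` for its block form. -/
noncomputable def theta {R : Type*} [CommRing R] (t : Rˣ) (k j : ℕ) : GLInf R :=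
  ⟨LinearEquiv.ofLinearMap (Finsupp.linearCombination R (thetaCol t k j))
    (Finsupp.linearCombination R (thetaInvCol t k j))
    (Finsupp.lhom_ext' fun c => LinearMap.ext_ring (by
      simp only [LinearMap.comp_apply, Finsupp.lsingle_apply, lc_single, one_smul,
        LinearMap.id_apply]
      exact theta_mul_inv t k j c))
    (Finsupp.lhom_ext' fun c => LinearMap.ext_ring (by
      simp only [LinearMap.comp_apply, Finsupp.lsingle_apply, lc_single, one_smul,
        LinearMap.id_apply]
      exact theta_inv_mul t k j c)),
    (isFinitary_iff _).2 ⟨k + 2 * j, fun c hc => by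
      rw [LinearEquiv.coe_ofLinearMap, lc_single, one_smul, thetaCol, if_neg (by omega),
        if_neg (by omega), if_neg (by omega)]⟩⟩

/-- In block form (blocks of sizes `k, j, j, ∞`)
`Θ_j[k] = [[1, 0, 0, 0], [0, V, t ^ j, 0], [0, 1, 0, 0], [0, 0, 0, 1]]`, where every row of `V`
is `(1 - t) (1, t, …, t ^ (j - 1))`. -/
theorem theta_entry {R : Type*} [CommRing R] (t : Rˣ) (k j a b : ℕ) :
    entry (theta t k j) a b =
      if k ≤ a ∧ a < k + j ∧ k ≤ b ∧ b < k + j then (1 - (t : R)) * (t : R) ^ (b - k)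
      else if k ≤ a ∧ a < k + j ∧ b = a + j then (t : R) ^ j
      else if k ≤ b ∧ b < k + j ∧ a = b + j then 1
      else if a = b ∧ (a < k ∨ k + 2 * j ≤ a) then 1
      else 0 := by
  have h0 : entry (theta t k j) a b = thetaCol t k j b a := by
    change Finsupp.linearCombination R (thetaCol t k j) (Finsupp.single b 1) a = _
    rw [lc_single, one_smul]
  have hs : ∀ r : R, (∑ i ∈ Finset.range j, Finsupp.single (k + i) r) a =
      if k ≤ a ∧ a < k + j then r else 0 := by
    intro r
    rw [Finsupp.finsetSum_apply]
    simp only [Finsupp.single_apply]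
    split_ifs with h
    · rw [Finset.sum_eq_single (a - k)]
      · rw [if_pos (by omega)]
      · intro i _ hi
        rw [if_neg (by omega)]
      · intro hi
        exact absurd (Finset.mem_range.2 (by omega)) hi
    · refine Finset.sum_eq_zero fun i hi => ?_
      have := Finset.mem_range.1 hi
      rw [if_neg (by omega)]
  rw [h0, thetaCol]
  by_cases h1 : b < k
  · rw [if_pos h1, Finsupp.single_apply]
    split_ifs <;> first | rfl | omega
  · by_cases h2 : b < k + j
    · rw [if_neg h1, if_pos h2, Finsupp.add_apply, hs, Finsupp.single_apply]
      split_ifs <;> first | omega | simp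
    · by_cases h3 : b < k + 2 * j
      · rw [if_neg h1, if_neg h2, if_pos h3, Finsupp.single_apply]
        split_ifs <;> first | rfl | omega
      · rw [if_neg h1, if_neg h2, if_neg h3, Finsupp.single_apply]
        split_ifs <;> first | rfl | omega

/-! The usual product: permutation matrices -/

/-- The map exchanging `k + i` and `k + j + i` for `0 ≤ i < j` and fixing everything else. -/
def swapFun (k j i : ℕ) : ℕ :=
  if k ≤ i ∧ i < k + j then i + j else if k + j ≤ i ∧ i < k + 2 * j then i - j else i

theorem swapFun_involutive (k j : ℕ) : Function.Involutive (swapFun k j) := by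
  intro i
  unfold swapFun
  split_ifs <;> omega

/-- The permutation matrix in `GL(∞)` with blocks
`[[1_k, 0, 0, 0], [0, 0, 1_j, 0], [0, 1_j, 0, 0], [0, 0, 0, 1_∞]]`. -/
noncomputable def swap (R : Type*) [CommRing R] (k j : ℕ) : GLInf R :=
  ⟨Finsupp.domLCongr (swapFun_involutive k j).toPerm,
    (isFinitary_iff _).2 ⟨k + 2 * j, fun c hc => by
      rw [Finsupp.domLCongr_single, Function.Involutive.coe_toPerm, swapFun, if_neg (by omega),
        if_neg (by omega)]⟩⟩

/-! Change of the base ring -/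

/-- Apply a ring homomorphism to the entries of a (column finite) matrix. -/
noncomputable def mapEnd {R S : Type*} [CommRing R] [CommRing S] (f : R →+* S)
    (g : (ℕ →₀ R) →ₗ[R] (ℕ →₀ R)) : (ℕ →₀ S) →ₗ[S] (ℕ →₀ S) :=
  Finsupp.linearCombination S fun j =>
    Finsupp.mapRange f (map_zero f) (g (Finsupp.single j 1))

theorem mapEnd_apply {R S : Type*} [CommRing R] [CommRing S] (f : R →+* S)
    (g : (ℕ →₀ R) →ₗ[R] (ℕ →₀ R)) (x : ℕ →₀ R) :
    mapEnd f g (Finsupp.mapRange f (map_zero f) x) = Finsupp.mapRange f (map_zero f) (g x) := by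
  induction x using Finsupp.induction_linear with
  | zero => simp
  | add x y hx hy =>
    rw [Finsupp.mapRange_add (map_add f), map_add, hx, hy, map_add,
      Finsupp.mapRange_add (map_add f)]
  | single j r =>
    rw [Finsupp.mapRange_single, mapEnd, Finsupp.linearCombination_single]
    have : Finsupp.single j r = r • Finsupp.single j (1 : R) := by simp
    rw [this, map_smul]
    ext i
    simp

theorem mapEnd_comp {R S : Type*} [CommRing R] [CommRing S] (f : R →+* S)
    (g h : (ℕ →₀ R) →ₗ[R] (ℕ →₀ R)) : mapEnd f g ∘ₗ mapEnd f h = mapEnd f (g ∘ₗ h) := by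
  refine Finsupp.lhom_ext' fun j => LinearMap.ext_ring ?_
  have key : ∀ e : (ℕ →₀ R) →ₗ[R] (ℕ →₀ R), mapEnd f e (Finsupp.single j 1) =
      Finsupp.mapRange f (map_zero f) (e (Finsupp.single j 1)) := by
    intro e
    simp [mapEnd]
  simp only [LinearMap.comp_apply, Finsupp.lsingle_apply]
  rw [key, key, mapEnd_apply, LinearMap.comp_apply]

theorem mapEnd_id {R S : Type*} [CommRing R] [CommRing S] (f : R →+* S) :
    mapEnd f (LinearMap.id : (ℕ →₀ R) →ₗ[R] (ℕ →₀ R)) = LinearMap.id := by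
  refine Finsupp.lhom_ext' fun j => LinearMap.ext_ring ?_
  simp [mapEnd]

/-- The group homomorphism `GL(∞)` over `R` to `GL(∞)` over `S` that applies the ring
homomorphism `f : R → S` to every entry; see `map_entry`. -/
noncomputable def map {R S : Type*} [CommRing R] [CommRing S] (f : R →+* S) :
    GLInf R →* GLInf S where
  toFun g := ⟨LinearEquiv.ofLinearMap (mapEnd f g.1.toLinearMap) (mapEnd f g.1.symm.toLinearMap)
      (by rw [mapEnd_comp, LinearEquiv.comp_coe, LinearEquiv.symm_trans_self,
        LinearEquiv.refl_toLinearMap, mapEnd_id])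
      (by rw [mapEnd_comp, LinearEquiv.comp_coe, LinearEquiv.self_trans_symm,
        LinearEquiv.refl_toLinearMap, mapEnd_id]),
    by
      obtain ⟨N, hN⟩ := (isFinitary_iff _).1 g.2
      refine (isFinitary_iff _).2 ⟨N, fun c hc => ?_⟩
      simp [mapEnd, hN c hc]⟩
  map_one' := by
    apply Subtype.ext
    apply LinearEquiv.toLinearMap_injective
    exact mapEnd_id f
  map_mul' g h := by
    apply Subtype.ext
    apply LinearEquiv.toLinearMap_injective
    exact (mapEnd_comp f g.1.toLinearMap h.1.toLinearMap).symm

theorem map_entry {R S : Type*} [CommRing R] [CommRing S] (f : R →+* S) (g : GLInf R)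
    (i j : ℕ) : entry (map f g) i j = f (entry g i j) := by
  change mapEnd f g.1.toLinearMap (Finsupp.single j 1) i = _
  simp [mapEnd, entry, autEntry]

end GLInf

/-- The variable `t` as a unit of `ℤ[t, t⁻¹]`. -/
noncomputable def tUnit : (ℤ[T;T⁻¹])ˣ :=
  ⟨LaurentPolynomial.T 1, LaurentPolynomial.T (-1),
    by rw [← LaurentPolynomial.T_add]; simp, by rw [← LaurentPolynomial.T_add]; simp⟩

/-- The subgroup `G[n]` of `GL(∞)` over `ℤ[t, t⁻¹]`: the matrices `1_n ⊕ X` with `vᵀ X = vᵀ` for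
`v = (1, t, t², …)` and `X u = u` for `u = (1, 1, 1, …)`. -/
noncomputable def G (n : ℕ) : Subgroup (GLInf ℤ[T;T⁻¹]) :=
  GLInf.blockStabilizer (fun i => (tUnit : ℤ[T;T⁻¹]) ^ i) (fun _ => 1) n

/-- The analogue of `G[n]` for `t = 1`, where `v = u = (1, 1, 1, …)`: the integral matrices `1_n ⊕ X` such that all row sums and all
column sums of `X` are equal to `1`. -/
def G₁ (n : ℕ) : Subgroup (GLInf ℤ) :=
  GLInf.blockStabilizer (fun _ => 1) (fun _ => 1) n

/-- Setting `t = 1` in all the entries of a matrix. -/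
noncomputable def atOne : GLInf ℤ[T;T⁻¹] →* GLInf ℤ :=
  GLInf.map (LaurentPolynomial.eval₂ (RingHom.id ℤ) 1)

/-- A family of binary operations `K[n]\Γ/K[k] × K[k]\Γ/K[m] → K[n]\Γ/K[m]` on the double cosets
of a group `Γ` with respect to a family of subgroups `K[n]`. -/
abbrev DoubleCosetOp {Γ : Type*} [Group Γ] (K : ℕ → Subgroup Γ) :=
  ∀ n k m : ℕ, DoubleCoset.Quotient (K n : Set Γ) (K k) → DoubleCoset.Quotient (K k : Set Γ) (K m) →
    DoubleCoset.Quotient (K n : Set Γ) (K m)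

/-- For all representatives `p`, `q`, the product of the double cosets `K[n] p K[k]` and
`K[k] q K[m]` is the double coset `K[n] p θ_j[k] q K[m]` for all sufficiently large `j`. -/
def IsStableProduct {Γ : Type*} [Group Γ] (K : ℕ → Subgroup Γ) (θ : ℕ → ℕ → Γ)
    (μ : DoubleCosetOp K) : Prop :=
  ∀ (n k m : ℕ) (p q : Γ), ∃ j₀ : ℕ, ∀ j, j₀ ≤ j →
    DoubleCoset.mk (K n) (K m) (p * θ k j * q) =
      μ n k m (DoubleCoset.mk (K n) (K k) p) (DoubleCoset.mk (K k) (K m) q)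

/-- Associativity of a family of operations on double cosets. -/
def IsAssocOp {Γ : Type*} [Group Γ] (K : ℕ → Subgroup Γ) (μ : DoubleCosetOp K) : Prop :=
  ∀ (n k l m : ℕ) (a : DoubleCoset.Quotient (K n : Set Γ) (K k))
    (b : DoubleCoset.Quotient (K k : Set Γ) (K l)) (c : DoubleCoset.Quotient (K l : Set Γ) (K m)),
    μ n l m (μ n k l a b) c = μ n k m a (μ k l m b c)

/-! ### Double cosets in a group with an abstract braiding. -/

section DoubleCosets

variable {Γ : Type*} [Group Γ]

/-! `theta t k 1` is the unreduced Burau matrix of one elementary crossing, and `theta t k j` is the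
Burau matrix of the braid that crosses two adjacent groups of `j` strands (`braid_self`). Allowing
groups of unequal sizes `a` and `b` gives elements `β k a b` that satisfy the hexagon identities,
and these reduce the theorem to a formal argument about braidings.

Stability: a representative involves only finitely many coordinates, while enlarging a group of
strands multiplies `β` by a factor living far to the right. That factor commutes with the
representative and is absorbed by the outer subgroup, so `a` and `b` can be changed independently
(`mk_left_eq`, `mk_right_eq`). Associativity follows: once the sizes are free, `exchange` moves a
crossing from one side of the middle representative to the other.

Independence of representatives is where the two conditions defining the stabilizer enter. An
element of `K k` must slide through `β k j j` and come out in `K (k + j)`, where it commutes with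
the other factors. Sliding to the left uses `vᵀ X = vᵀ`, because the rows of the block `V` are
proportional to `v`; sliding to the right uses `X u = u`, because the columns of `V` are
proportional to `u` (`theta_slide_left`, `theta_slide_right`).

All this works over any commutative ring with a unit `t`. For `t = 1` the block `V` vanishes and the
Burau matrix is a permutation matrix, so the usual product is the same theorem over `ℤ`. -/

/-- A family of elements `β k a b` of a filtered group that behaves like the braids crossing `a`
strands with `b` strands to the right of the first `k` strands: it satisfies the hexagon
identities, and the subgroups `K n` of elements to the right of the first `n` strands slide
through `β k j j` for large `j`. The subgroup `L n` consists of elements on the first `n`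
strands. -/
structure IsBraiding (K L : ℕ → Subgroup Γ) (β : ℕ → ℕ → ℕ → Γ) : Prop where
  antitone : Antitone K
  monotone : Monotone L
  exists_mem : ∀ g, ∃ N, g ∈ L N
  commute : ∀ {N g h}, g ∈ L N → h ∈ K N → g * h = h * g
  mem : ∀ k a b, β k a b ∈ K k
  add_left : ∀ k a a' b, β k (a + a') b = β (k + a) a' b * β k a b
  add_right : ∀ k a b b', β k a (b + b') = β k a b * β (k + b) a b'
  slide_left : ∀ {k h}, h ∈ K k → ∃ j₀, ∀ j, j₀ ≤ j → ∃ h' ∈ K (k + j),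
    β k j j * h = h' * β k j j
  slide_right : ∀ {k h}, h ∈ K k → ∃ j₀, ∀ j, j₀ ≤ j → ∃ h' ∈ K (k + j),
    h * β k j j = β k j j * h'

theorem DoubleCoset.mk_mul_left {H K : Subgroup Γ} {h : Γ} (hh : h ∈ H) (g : Γ) :
    DoubleCoset.mk H K (h * g) = DoubleCoset.mk H K g :=
  ((DoubleCoset.eq H K _ _).2 ⟨h, hh, 1, K.one_mem, by simp⟩).symm

theorem DoubleCoset.mk_mul_right {H K : Subgroup Γ} {h : Γ} (hh : h ∈ K) (g : Γ) :
    DoubleCoset.mk H K (g * h) = DoubleCoset.mk H K g :=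
  ((DoubleCoset.eq H K _ _).2 ⟨1, H.one_mem, h, hh, by simp⟩).symm

namespace IsBraiding

variable {K L : ℕ → Subgroup Γ} {β : ℕ → ℕ → ℕ → Γ}

/-- By `add_left` the surplus strands contribute a left factor in `K (k + a')`, which commutes past
`p` and is absorbed by `K n`. The size `b` is untouched, and this is what associativity needs. -/
theorem mk_left_eq (hβ : IsBraiding K L β)
    {N n m k a a' b : ℕ} {p : Γ} (hp : p ∈ L N) (hn : n ≤ N) (ha : N ≤ k + a)
    (ha' : N ≤ k + a') (x : Γ) :
    DoubleCoset.mk (K n) (K m) (p * β k a b * x) =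
      DoubleCoset.mk (K n) (K m) (p * β k a' b * x) := by
  wlog h : a' ≤ a generalizing a a'
  · exact (this ha' ha (le_of_not_ge h)).symm
  obtain ⟨c, rfl⟩ := Nat.exists_eq_add_of_le h
  have hc : p * β (k + a') c b = β (k + a') c b * p :=
    hβ.commute (hβ.monotone ha' hp) (hβ.mem _ _ _)
  rw [hβ.add_left, ← mul_assoc, hc, mul_assoc, mul_assoc,
    DoubleCoset.mk_mul_left (hβ.antitone (hn.trans ha') (hβ.mem _ _ _)), ← mul_assoc]

theorem mk_right_eq (hβ : IsBraiding K L β)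
    {N n m k a b b' : ℕ} {q : Γ} (hq : q ∈ L N) (hm : m ≤ N) (hb : N ≤ k + b)
    (hb' : N ≤ k + b') (x : Γ) :
    DoubleCoset.mk (K n) (K m) (x * β k a b * q) =
      DoubleCoset.mk (K n) (K m) (x * β k a b' * q) := by
  wlog h : b' ≤ b generalizing b b'
  · exact (this hb' hb (le_of_not_ge h)).symm
  obtain ⟨c, rfl⟩ := Nat.exists_eq_add_of_le h
  have hc : q * β (k + b') a c = β (k + b') a c * q :=
    hβ.commute (hβ.monotone hb' hq) (hβ.mem _ _ _)
  rw [hβ.add_right, ← mul_assoc, mul_assoc _ _ q, ← hc, ← mul_assoc,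
    DoubleCoset.mk_mul_right (hβ.antitone (hm.trans hb') (hβ.mem _ _ _))]

theorem exists_mem_three (hβ : IsBraiding K L β) (p q r : Γ) (n : ℕ) : ∃ N, n ≤ N ∧ p ∈ L N ∧ q ∈ L N ∧ r ∈ L N := by
  obtain ⟨a, ha⟩ := hβ.exists_mem p
  obtain ⟨b, hb⟩ := hβ.exists_mem q
  obtain ⟨c, hc⟩ := hβ.exists_mem r
  exact ⟨n + a + b + c, by omega, hβ.monotone (by omega) ha, hβ.monotone (by omega) hb,
    hβ.monotone (by omega) hc⟩

theorem eventually_const (hβ : IsBraiding K L β) (n k m : ℕ) (p q : Γ) : ∃ j₀, ∀ i j, j₀ ≤ i → j₀ ≤ j →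
    DoubleCoset.mk (K n) (K m) (p * β k i i * q) =
      DoubleCoset.mk (K n) (K m) (p * β k j j * q) := by
  obtain ⟨N, hN, hp, hq, -⟩ := hβ.exists_mem_three p q 1 (n + m)
  refine ⟨N, fun i j hi hj => ?_⟩
  rw [hβ.mk_left_eq hp (by omega) (by omega : N ≤ k + i) (by omega : N ≤ k + j),
    hβ.mk_right_eq hq (by omega) (by omega : N ≤ k + i) (by omega : N ≤ k + j)]

/-- The inner factors `h` and `h₁` from `K k` slide through `β` in opposite directions, commute with
what they meet, and end in the outer subgroups. -/
theorem eventually_congr (hβ : IsBraiding K L β) {n k m : ℕ} {p p' q q' : Γ}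
    (hp : DoubleCoset.mk (K n) (K k) p = DoubleCoset.mk (K n) (K k) p')
    (hq : DoubleCoset.mk (K k) (K m) q = DoubleCoset.mk (K k) (K m) q') :
    ∃ j₀, ∀ j, j₀ ≤ j → DoubleCoset.mk (K n) (K m) (p * β k j j * q) =
      DoubleCoset.mk (K n) (K m) (p' * β k j j * q') := by
  obtain ⟨x, hx, h, hh, rfl⟩ := (DoubleCoset.eq _ _ _ _).1 hp
  obtain ⟨h₁, hh₁, y, hy, rfl⟩ := (DoubleCoset.eq _ _ _ _).1 hq
  obtain ⟨N, hN, hp, hq, -⟩ := hβ.exists_mem_three p (h₁ * q) 1 (n + m)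
  obtain ⟨a, ha⟩ := hβ.slide_right hh
  obtain ⟨b, hb⟩ := hβ.slide_left hh₁
  refine ⟨N + a + b, fun j hj => ?_⟩
  obtain ⟨g, hg, hg'⟩ := ha j (by omega)
  obtain ⟨g₁, hg₁, hg₁'⟩ := hb j (by omega)
  have hcg : h₁ * q * g = g * (h₁ * q) := hβ.commute (hβ.monotone (by omega) hq) hg
  have hcg₁ : p * g₁ = g₁ * p := hβ.commute (hβ.monotone (by omega) hp) hg₁
  -- `h` goes first and has to pass `h₁ * q` as a whole, so `N` was chosen to bound `h₁ * q` and not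
  -- `q` alone.
  have e : x * p * h * β k j j * (h₁ * q * y) = x * (g₁ * (p * β k j j * q * (g * y))) := by
    calc x * p * h * β k j j * (h₁ * q * y) = x * p * (h * β k j j) * (h₁ * q) * y := by group
      _ = x * p * β k j j * (g * (h₁ * q)) * y := by rw [hg']; group
      _ = x * p * (β k j j * h₁) * q * g * y := by rw [← hcg]; group
      _ = x * (p * g₁) * β k j j * q * g * y := by rw [hg₁']; group
      _ = _ := by rw [hcg₁]; group
  rw [e, DoubleCoset.mk_mul_left hx,
    DoubleCoset.mk_mul_left (hβ.antitone (by omega) hg₁),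
    DoubleCoset.mk_mul_right ((K m).mul_mem (hβ.antitone (by omega) hg) hy)]

theorem exists_isStableProduct (hβ : IsBraiding K L β) : ∃ μ : DoubleCosetOp K,
    IsStableProduct K (fun k j => β k j j) μ := by
  choose J hJ using hβ.eventually_const
  refine ⟨fun n k m P Q => DoubleCoset.mk (K n) (K m)
    (P.out * β k (J n k m P.out Q.out) (J n k m P.out Q.out) * Q.out), fun n k m p q => ?_⟩
  dsimp only
  set P := DoubleCoset.mk (K n) (K k) p
  set Q := DoubleCoset.mk (K k) (K m) q
  obtain ⟨j₀, h⟩ := hβ.eventually_congr (p := p) (p' := P.out) (q := q) (q' := Q.out)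
    (DoubleCoset.out_eq' _ _ _).symm (DoubleCoset.out_eq' _ _ _).symm
  exact ⟨j₀ + J n k m P.out Q.out, fun j hj => (h j (by omega)).trans
    (hJ n k m _ _ _ _ (by omega) le_rfl)⟩

/-- Both sides contain the same crossing `β (k + b) a d = β (l + c) a d`, split off on the left by
`add_right` and on the right by `add_left`; it lies beyond the reach of `q` and commutes with it. -/
theorem exchange (hβ : IsBraiding K L β) {k l a b c d : ℕ} {q : Γ} (h : k + b = l + c) (hq : q ∈ L (k + b)) :
    β k a (b + d) * q * β l c d = β k a b * q * β l (c + a) d := by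
  have hc : q * β (k + b) a d = β (k + b) a d * q := hβ.commute hq (hβ.mem _ _ _)
  rw [hβ.add_right, hβ.add_left, mul_assoc _ _ q, ← hc, h]
  simp only [mul_assoc]

theorem isAssocOp (hβ : IsBraiding K L β) {μ : DoubleCosetOp K} (hμ : IsStableProduct K (fun k j => β k j j) μ) :
    IsAssocOp K μ := by
  intro n k l m A B C
  obtain ⟨p, rfl⟩ := Quotient.exists_rep A
  obtain ⟨q, rfl⟩ := Quotient.exists_rep B
  obtain ⟨r, rfl⟩ := Quotient.exists_rep C
  change μ n l m (μ n k l (DoubleCoset.mk _ _ p) (DoubleCoset.mk _ _ q)) (DoubleCoset.mk _ _ r) =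
    μ n k m (DoubleCoset.mk _ _ p) (μ k l m (DoubleCoset.mk _ _ q) (DoubleCoset.mk _ _ r))
  obtain ⟨N, hN, hp, hq, hr⟩ := hβ.exists_mem_three p q r (n + m)
  obtain ⟨jpq, hpq⟩ := hμ n k l p q
  obtain ⟨jqr, hqr⟩ := hμ k l m q r
  set j := jpq + N + l + jqr with hj
  set c := k + j - l with hc
  rw [← hpq j (by omega), ← hqr c (by omega)]
  obtain ⟨j₁, h₁⟩ := hμ n l m (p * β k j j * q) r
  obtain ⟨j₂, h₂⟩ := hμ n k m p (q * β l c c * r)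
  rw [← h₁ (c + (j₁ + N)) (by omega), ← h₂ (j + (N + j₂)) (by omega)]
  -- Only the sizes adjacent to `p` and to `r` are adjusted by `mk_left_eq` and `mk_right_eq`; the
  -- sizes facing `q` change through `exchange` alone.
  calc DoubleCoset.mk (K n) (K m)
        (p * β k j j * q * β l (c + (j₁ + N)) (c + (j₁ + N)) * r)
      = DoubleCoset.mk (K n) (K m) (p * β k j j * q * β l (c + (j₁ + N)) (N + j₂) * r) :=
        hβ.mk_right_eq hr (by omega) (by omega) (by omega) _
    _ = DoubleCoset.mk (K n) (K m) (p * β k j j * (q * β l (c + (j₁ + N)) (N + j₂) * r)) := by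
        simp only [mul_assoc]
    _ = DoubleCoset.mk (K n) (K m)
          (p * β k (j₁ + N) j * (q * β l (c + (j₁ + N)) (N + j₂) * r)) :=
        hβ.mk_left_eq hp (by omega) (by omega) (by omega) _
    _ = DoubleCoset.mk (K n) (K m)
          (p * (β k (j₁ + N) j * q * β l (c + (j₁ + N)) (N + j₂)) * r) := by
        simp only [mul_assoc]
    _ = DoubleCoset.mk (K n) (K m)
          (p * (β k (j₁ + N) (j + (N + j₂)) * q * β l c (N + j₂)) * r) := by
        rw [hβ.exchange (by omega) (hβ.monotone (by omega) hq)]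
    _ = DoubleCoset.mk (K n) (K m)
          (p * β k (j₁ + N) (j + (N + j₂)) * (q * β l c (N + j₂) * r)) := by
        simp only [mul_assoc]
    _ = DoubleCoset.mk (K n) (K m)
          (p * β k (j + (N + j₂)) (j + (N + j₂)) * (q * β l c (N + j₂) * r)) :=
        hβ.mk_left_eq hp (by omega) (by omega) (by omega) _
    _ = DoubleCoset.mk (K n) (K m)
          (p * β k (j + (N + j₂)) (j + (N + j₂)) * q * β l c (N + j₂) * r) := by
        simp only [mul_assoc]
    _ = DoubleCoset.mk (K n) (K m)
          (p * β k (j + (N + j₂)) (j + (N + j₂)) * q * β l c c * r) :=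
        hβ.mk_right_eq hr (by omega) (by omega) (by omega) _
    _ = _ := by simp only [mul_assoc]

end IsBraiding

end DoubleCosets

/-! ### The stabilizers as subgroups of `GL(∞)`. -/

namespace GLInf

section Stabilizers

variable {R : Type*} [CommRing R]

theorem hom_ext {M : Type*} [AddCommGroup M] [Module R M] {f g : (ℕ →₀ R) →ₗ[R] M}
    (h : ∀ c, f (Finsupp.single c 1) = g (Finsupp.single c 1)) : f = g :=
  Finsupp.lhom_ext' fun c => LinearMap.ext_ring (h c)

theorem inv_apply_apply (g : GLInf R) (x : ℕ →₀ R) : (g⁻¹).1 (g.1 x) = x :=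
  LinearEquiv.symm_apply_apply g.1 x

theorem apply_inv_apply (g : GLInf R) (x : ℕ →₀ R) : g.1 ((g⁻¹).1 x) = x :=
  LinearEquiv.apply_symm_apply g.1 x

/-- The matrices that agree with the identity matrix in the rows and columns with index in `s`. -/
def fixing (R : Type*) [CommRing R] (s : Set ℕ) : Subgroup (GLInf R) where
  carrier := {g | (∀ j ∈ s, g.1 (Finsupp.single j 1) = Finsupp.single j 1) ∧
    ∀ i ∈ s, ∀ x, g.1 x i = x i}
  one_mem' := ⟨fun _ _ => rfl, fun _ _ _ => rfl⟩
  mul_mem' := by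
    rintro a b ⟨ha, ha'⟩ ⟨hb, hb'⟩
    refine ⟨fun j hj => ?_, fun i hi x => ?_⟩
    · change a.1 (b.1 _) = _
      rw [hb j hj, ha j hj]
    · change a.1 (b.1 _) i = _
      rw [ha' i hi, hb' i hi]
  inv_mem' := by
    rintro a ⟨ha, ha'⟩
    refine ⟨fun j hj => ?_, fun i hi x => ?_⟩
    · conv_lhs => rw [← ha j hj]
      exact inv_apply_apply a _
    · rw [← ha' i hi, apply_inv_apply]

theorem mem_fixing_iff_entry {s : Set ℕ} {g : GLInf R} : g ∈ fixing R s ↔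
    ∀ i j, i ∈ s ∨ j ∈ s → entry g i j = if i = j then 1 else 0 := by
  constructor
  · rintro ⟨h, h'⟩ i j (hi | hj)
    · simp [entry, autEntry, h' i hi, Finsupp.single_apply, eq_comm]
    · simp [entry, autEntry, h j hj, Finsupp.single_apply, eq_comm]
  · intro h
    refine ⟨fun j hj => ?_, fun i hi x => ?_⟩
    · ext i
      simpa [entry, autEntry, Finsupp.single_apply, eq_comm] using h i j (Or.inr hj)
    · have : Finsupp.lapply i ∘ₗ g.1.toLinearMap = Finsupp.lapply (R := R) i := by
        refine hom_ext fun c => ?_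
        simpa [entry, autEntry, Finsupp.single_apply, eq_comm] using h i c (Or.inl hi)
      exact LinearMap.congr_fun this x

theorem fixing_mono {s s' : Set ℕ} (h : s ⊆ s') : fixing R s' ≤ fixing R s :=
  fun _ hg => ⟨fun j hj => hg.1 j (h hj), fun i hi => hg.2 i (h hi)⟩

theorem exists_mem_fixing (g : GLInf R) : ∃ N, g ∈ fixing R (Set.Ici N) := by
  obtain ⟨N, hN⟩ := (g.2.image fun a => a.1 + a.2).bddAbove
  refine ⟨N + 1, mem_fixing_iff_entry.2 fun i j hij => ?_⟩
  by_contra hne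
  have : i + j ≤ N := hN ⟨(i, j), hne, rfl⟩
  simp only [Set.mem_Ici] at hij
  omega

theorem apply_eq_self {s : Set ℕ} {g : GLInf R} (hg : g ∈ fixing R s) {x : ℕ →₀ R}
    (hx : ∀ i, i ∉ s → x i = 0) : g.1 x = x := by
  have e : x = ∑ i ∈ x.support, x i • Finsupp.single i (1 : R) := by
    conv_lhs => rw [← Finsupp.sum_single x]
    simp [Finsupp.sum]
  rw [e, map_sum]
  refine Finset.sum_congr rfl fun i hi => ?_
  rw [map_smul, hg.1 i]
  by_contra h
  exact Finsupp.mem_support_iff.1 hi (hx i h)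

/-- `g` acts only on the coordinates outside `s`, and `h` only on those in `s`. -/
theorem commute_of_fixing {s : Set ℕ} {g h : GLInf R} (hg : g ∈ fixing R s)
    (hh : h ∈ fixing R sᶜ) : g * h = h * g := by
  apply Subtype.ext
  apply LinearEquiv.toLinearMap_injective
  refine hom_ext fun c => ?_
  change g.1 (h.1 (Finsupp.single c 1)) = h.1 (g.1 (Finsupp.single c 1))
  by_cases hc : c ∈ s
  · rw [hg.1 c hc]
    refine apply_eq_self hg fun i hi => ?_
    rw [hh.2 i hi, Finsupp.single_eq_of_ne]
    rintro rfl
    exact hi hc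
  · rw [hh.1 c hc]
    refine (apply_eq_self hh fun i hi => ?_).symm
    rw [Set.notMem_compl_iff] at hi
    rw [hg.2 i hi, Finsupp.single_eq_of_ne]
    rintro rfl
    exact hc hi

theorem mem_blockStabilizer_zero {v u : ℕ → R} {g : GLInf R} :
    g ∈ blockStabilizer v u 0 ↔ FixesRow v g ∧ FixesCol u g := by
  have key : ∀ X : GLInf R, IsBlock 0 g X ↔ g = X := fun X =>
    ⟨fun h => ext_entry fun i j => by simpa using h i j, by rintro rfl i j; simp⟩
  constructor
  · rintro ⟨X, hX, hX', h⟩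
    obtain rfl := (key X).1 h
    exact ⟨hX, hX'⟩
  · rintro ⟨h, h'⟩
    exact ⟨g, h, h', (key g).2 rfl⟩

theorem shift_apply (n : ℕ) (x : ℕ →₀ R) (i : ℕ) :
    Finsupp.lmapDomain R R (· + n) x i = if n ≤ i then x (i - n) else 0 := by
  split_ifs with hi
  · obtain ⟨k, rfl⟩ := Nat.exists_eq_add_of_le' hi
    rw [Nat.add_sub_cancel]
    exact Finsupp.mapDomain_apply (add_left_injective n) x k
  · refine Finsupp.mapDomain_of_notMem_range x i ?_
    rintro ⟨k, rfl⟩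
    exact hi (by simp)

/-- The inverse of the shift by `n`, discarding the first `n` coordinates. -/
noncomputable def unshift (n : ℕ) : (ℕ →₀ R) →ₗ[R] (ℕ →₀ R) :=
  Finsupp.lcomapDomain (· + n) (add_left_injective n)

theorem unshift_apply (n : ℕ) (x : ℕ →₀ R) (i : ℕ) : unshift n x i = x (i + n) := rfl

theorem unshift_shift (n : ℕ) (x : ℕ →₀ R) :
    unshift n (Finsupp.lmapDomain R R (· + n) x) = x := by
  ext i
  rw [unshift_apply, shift_apply, if_pos (by omega), Nat.add_sub_cancel]

theorem shift_unshift {n : ℕ} {x : ℕ →₀ R} (hx : ∀ i < n, x i = 0) :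
    Finsupp.lmapDomain R R (· + n) (unshift n x) = x := by
  ext i
  rw [shift_apply]
  split_ifs with hi
  · rw [unshift_apply, Nat.sub_add_cancel hi]
  · exact (hx i (by omega)).symm

theorem linearCombination_shift (t : R) (n : ℕ) (x : ℕ →₀ R) :
    Finsupp.linearCombination R (fun i => t ^ i) (Finsupp.lmapDomain R R (· + n) x) =
      t ^ n * Finsupp.linearCombination R (fun i => t ^ i) x := by
  have : Finsupp.linearCombination R (fun i => t ^ i) ∘ₗ Finsupp.lmapDomain R R (· + n) =
      t ^ n • Finsupp.linearCombination R (fun i => t ^ i) := by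
    refine hom_ext fun c => ?_
    simp [pow_add, mul_comm]
  exact LinearMap.congr_fun this x

theorem shift_trunc_one (n N : ℕ) :
    Finsupp.lmapDomain R R (· + n) (trunc (fun _ => 1) N) =
      trunc (fun _ => 1) (N + n) - trunc (fun _ => 1) n := by
  ext i
  rw [shift_apply, Finsupp.sub_apply, trunc_apply, trunc_apply, trunc_apply]
  split_ifs <;> first | omega | simp

/-- The block diagonal matrix `1_n ⊕ X` has left upper block `1_n`, so its lower right block
`X` is invertible. -/
theorem exists_isBlock {n : ℕ} {g : GLInf R} (hg : g ∈ fixing R (Set.Iio n)) :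
    ∃ X : GLInf R, IsBlock n g X := by
  have key : ∀ g : GLInf R, g ∈ fixing R (Set.Iio n) → ∀ x,
      Finsupp.lmapDomain R R (· + n) (unshift n (g.1 (Finsupp.lmapDomain R R (· + n) x))) =
        g.1 (Finsupp.lmapDomain R R (· + n) x) := fun g hg x => by
    refine shift_unshift fun i hi => ?_
    rw [hg.2 i hi, shift_apply, if_neg (by omega)]
  let X : (ℕ →₀ R) ≃ₗ[R] (ℕ →₀ R) := LinearEquiv.ofLinearMap
    (unshift n ∘ₗ g.1.toLinearMap ∘ₗ Finsupp.lmapDomain R R (· + n))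
    (unshift n ∘ₗ (g⁻¹).1.toLinearMap ∘ₗ Finsupp.lmapDomain R R (· + n))
    (LinearMap.ext fun x => by
      simp only [LinearMap.comp_apply, LinearEquiv.coe_coe, LinearMap.id_apply]
      rw [key _ (inv_mem hg), apply_inv_apply, unshift_shift])
    (LinearMap.ext fun x => by
      simp only [LinearMap.comp_apply, LinearEquiv.coe_coe, LinearMap.id_apply]
      rw [key _ hg, inv_apply_apply, unshift_shift])
  obtain ⟨N, hN⟩ := (isFinitary_iff _).1 g.2
  refine ⟨⟨X, (isFinitary_iff _).2 ⟨N, fun j hj => ?_⟩⟩, (isBlock_iff _ _ _).2 ⟨hg.1, fun x => ?_⟩⟩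
  · change unshift n (g.1 (Finsupp.lmapDomain R R (· + n) (Finsupp.single j 1))) = _
    have e : g.1 (Finsupp.lmapDomain R R (· + n) (Finsupp.single j 1)) =
        Finsupp.lmapDomain R R (· + n) (Finsupp.single j 1) := by
      rw [Finsupp.lmapDomain_apply, Finsupp.mapDomain_single]
      exact hN _ (by omega)
    rw [e, unshift_shift]
  · exact (key g hg x).symm

/-- The group `blockStabilizer v u n` for `v = (1, t, t², …)` and `u = (1, 1, …)`. -/
abbrev stab (t : Rˣ) (n : ℕ) : Subgroup (GLInf R) :=
  blockStabilizer (fun i => (t : R) ^ i) (fun _ => 1) n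

theorem fixing_of_isBlock {n : ℕ} {g X : GLInf R} (h : IsBlock n g X) :
    g ∈ fixing R (Set.Iio n) := by
  refine mem_fixing_iff_entry.2 fun i j hij => ?_
  simp only [Set.mem_Iio] at hij
  rw [h i j, if_neg (by omega)]

/-- Since `v` is geometric, the shift by `n` multiplies the functional `v` by `t ^ n`, and this unit
can be cancelled. -/
theorem fixesRow_iff_of_isBlock (t : Rˣ) {n : ℕ} {g X : GLInf R} (h : IsBlock n g X) :
    FixesRow (fun i => (t : R) ^ i) g ↔ FixesRow (fun i => (t : R) ^ i) X := by
  have hg := (isBlock_iff _ _ _).1 h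
  rw [fixesRow_iff, fixesRow_iff]
  constructor
  · intro H x
    have := H (Finsupp.lmapDomain R R (· + n) x)
    rw [hg.2, linearCombination_shift, linearCombination_shift] at this
    exact ((t ^ n).isUnit.mul_right_inj).1 (by simpa using this)
  · intro H x
    have : Finsupp.linearCombination R (fun i => (t : R) ^ i) ∘ₗ g.1.toLinearMap =
        Finsupp.linearCombination R (fun i => (t : R) ^ i) := by
      refine hom_ext fun c => ?_
      simp only [LinearMap.comp_apply, LinearEquiv.coe_coe]
      by_cases hc : c < n
      · rw [hg.1 c hc]
      · obtain ⟨d, rfl⟩ := Nat.exists_eq_add_of_le' (not_lt.1 hc)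
        have := hg.2 (Finsupp.single d 1)
        rw [Finsupp.lmapDomain_apply, Finsupp.mapDomain_single] at this
        rw [this, linearCombination_shift, H]
        simp [pow_add, mul_comm]
    exact LinearMap.congr_fun this x

/-- The shift of a truncation of `u` is a difference of two truncations, the smaller of which is
supported where `g` is the identity. -/
theorem fixesCol_iff_of_isBlock {n : ℕ} {g X : GLInf R} (h : IsBlock n g X) :
    FixesCol (fun _ => 1) g ↔ FixesCol (fun _ => 1) X := by
  have hg := (isBlock_iff _ _ _).1 h
  have hn : g.1 (trunc (fun _ => 1) n) = trunc (fun _ => 1) n :=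
    apply_eq_self (fixing_of_isBlock h) fun i hi => by
      rw [trunc_apply, if_neg (by simpa using hi)]
  rw [fixesCol_iff, fixesCol_iff]
  have key : ∀ N, g.1 (trunc (fun _ => 1) (N + n)) = trunc (fun _ => 1) (N + n) ↔
      X.1 (trunc (fun _ => 1) N) = trunc (fun _ => 1) N := by
    intro N
    have e := hg.2 (trunc (fun _ => 1) N)
    rw [shift_trunc_one, map_sub, hn] at e
    constructor
    · intro h
      rw [h, ← shift_trunc_one] at e
      rw [← unshift_shift n (X.1 _), ← e, unshift_shift]
    · intro h
      rw [h, shift_trunc_one] at e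
      exact sub_left_injective e
  constructor
  · rintro ⟨N₀, H⟩
    exact ⟨N₀, fun N hN => (key N).1 (H _ (by omega))⟩
  · rintro ⟨N₀, H⟩
    refine ⟨N₀ + n, fun N hN => ?_⟩
    obtain ⟨M, rfl⟩ := Nat.exists_eq_add_of_le' (show n ≤ N by omega)
    exact (key M).2 (H M (by omega))

/-- This separates the block shape from a condition on `g` itself that does not depend on `n`, so
the subgroups are visibly nested. -/
theorem mem_stab_iff {t : Rˣ} {n : ℕ} {g : GLInf R} :
    g ∈ stab t n ↔ g ∈ fixing R (Set.Iio n) ∧ g ∈ stab t 0 := by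
  constructor
  · rintro ⟨X, hX, hX', h⟩
    exact ⟨fixing_of_isBlock h, mem_blockStabilizer_zero.2
      ⟨(fixesRow_iff_of_isBlock t h).2 hX, (fixesCol_iff_of_isBlock h).2 hX'⟩⟩
  · rintro ⟨h, h'⟩
    obtain ⟨X, hX⟩ := exists_isBlock h
    obtain ⟨h₁, h₂⟩ := mem_blockStabilizer_zero.1 h'
    exact ⟨X, (fixesRow_iff_of_isBlock t hX).1 h₁, (fixesCol_iff_of_isBlock hX).1 h₂, hX⟩

theorem stab_antitone (t : Rˣ) : Antitone (stab t) := by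
  intro n m h g hg
  obtain ⟨h₁, h₂⟩ := mem_stab_iff.1 hg
  exact mem_stab_iff.2 ⟨fixing_mono (Set.Iio_subset_Iio h) h₁, h₂⟩

end Stabilizers

end GLInf

/-! ### Burau matrices of crossings and the hexagon identities. -/

namespace GLInf

section Braids

variable {R : Type*} [CommRing R] (t : Rˣ)

theorem theta_single (k j c : ℕ) :
    (theta t k j).1 (Finsupp.single c 1) = thetaCol t k j c :=
  (lc_single _ _ _).trans (one_smul _ _)

theorem theta_inv_single (k j c : ℕ) :
    ((theta t k j)⁻¹).1 (Finsupp.single c 1) = thetaInvCol t k j c :=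
  (lc_single _ _ _).trans (one_smul _ _)

theorem apply_single (g : GLInf R) (c : ℕ) (r : R) :
    g.1 (Finsupp.single c r) = r • g.1 (Finsupp.single c 1) := by
  rw [← map_smul, Finsupp.smul_single, smul_eq_mul, mul_one]

theorem theta_mem_fixing_Iio (k j : ℕ) : theta t k j ∈ fixing R (Set.Iio k) := by
  refine mem_fixing_iff_entry.2 fun a b hab => ?_
  simp only [Set.mem_Iio] at hab
  rw [theta_entry]
  split_ifs <;> first | rfl | omega

theorem theta_mem_fixing_Ici {k j N : ℕ} (h : k + 2 * j ≤ N) :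
    theta t k j ∈ fixing R (Set.Ici N) := by
  refine mem_fixing_iff_entry.2 fun a b hab => ?_
  simp only [Set.mem_Ici] at hab
  rw [theta_entry]
  split_ifs <;> first | rfl | omega

/-- The nontrivial block is `[[1 - t, t], [1, 0]]`, which fixes the row `(1, t)` and the column `(1,
1)`. -/
theorem theta_one_mem_stab_zero (k : ℕ) : theta t k 1 ∈ stab t 0 := by
  have e₀ : thetaCol t k 1 k = Finsupp.single k (1 - (t : R)) + Finsupp.single (k + 1) 1 := by
    rw [thetaCol, if_neg (by omega), if_pos (by omega)]
    simp
  have e₁ : thetaCol t k 1 (k + 1) = Finsupp.single k (t : R) := by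
    rw [thetaCol, if_neg (by omega), if_neg (by omega), if_pos (by omega)]
    simp
  have e₂ : ∀ c, c ≠ k → c ≠ k + 1 → thetaCol t k 1 c = Finsupp.single c 1 := by
    intro c h h'
    unfold thetaCol
    split_ifs <;> first | rfl | omega
  refine mem_blockStabilizer_zero.2 ⟨(fixesRow_iff _ _).2 fun x => ?_,
    (fixesCol_iff _ _).2 ⟨k + 2, fun N hN => ?_⟩⟩
  · have : Finsupp.linearCombination R (fun i => (t : R) ^ i) ∘ₗ (theta t k 1).1.toLinearMap =
        Finsupp.linearCombination R (fun i => (t : R) ^ i) := by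
      refine hom_ext fun c => ?_
      simp only [LinearMap.comp_apply, LinearEquiv.coe_coe, theta_single]
      rcases eq_or_ne c k with rfl | h
      · rw [e₀]
        simp only [map_add, Finsupp.linearCombination_single, smul_eq_mul]
        ring
      · rcases eq_or_ne c (k + 1) with rfl | h'
        · rw [e₁]
          simp only [Finsupp.linearCombination_single, smul_eq_mul]
          ring
        · rw [e₂ c h h']
    exact LinearMap.congr_fun this x
  · set y := Finsupp.single k (1 : R) + Finsupp.single (k + 1) 1 with hy
    have h₁ : (theta t k 1).1 y = y := by
      rw [hy, map_add, theta_single, theta_single, e₀, e₁, add_right_comm, ← Finsupp.single_add,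
        sub_add_cancel]
    -- The remainder vanishes at `k` and `k + 1`, the only coordinates on which the matrix acts.
    have h₂ : (theta t k 1).1 (trunc (fun _ => 1) N - y) = trunc (fun _ => 1) N - y := by
      have hs : theta t k 1 ∈ fixing R {i | i < k ∨ k + 2 ≤ i} := by
        refine mem_fixing_iff_entry.2 fun a b hab => ?_
        simp only [Set.mem_ofPred_eq] at hab
        rw [theta_entry]
        split_ifs <;> first | rfl | omega
      refine apply_eq_self hs fun i hi => ?_
      simp only [Set.mem_ofPred_eq] at hi
      rw [Finsupp.sub_apply, trunc_apply, if_pos (by omega), hy, Finsupp.add_apply,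
        Finsupp.single_apply, Finsupp.single_apply]
      split_ifs <;> first | omega | simp
    rwa [map_sub, h₁, sub_left_inj] at h₂

theorem theta_one_mem_stab (k : ℕ) : theta t k 1 ∈ stab t k :=
  mem_stab_iff.2 ⟨theta_mem_fixing_Iio t k 1, theta_one_mem_stab_zero t k⟩

/-- The Burau matrix of the braid moving strand `k + b` to the left across the strands
`k, …, k + b - 1`. -/
noncomputable def strand (k : ℕ) : ℕ → GLInf R
  | 0 => 1
  | b + 1 => strand k b * theta t (k + b) 1

/-- The Burau matrix of the braid moving the strands `k + b, …, k + b + a - 1` to the left across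
the strands `k, …, k + b - 1`. -/
noncomputable def braid (k a b : ℕ) : GLInf R :=
  match a with
  | 0 => 1
  | a + 1 => strand t (k + a) b * braid k a b

theorem strand_succ (k b : ℕ) : strand t k (b + 1) = strand t k b * theta t (k + b) 1 := rfl

theorem braid_succ (k a b : ℕ) : braid t k (a + 1) b = strand t (k + a) b * braid t k a b := rfl

theorem strand_mem_stab (k b : ℕ) : strand t k b ∈ stab t k := by
  induction b with
  | zero => exact one_mem _
  | succ b ih => exact mul_mem ih (stab_antitone t (by omega) (theta_one_mem_stab t (k + b)))

theorem braid_mem_stab (k a b : ℕ) : braid t k a b ∈ stab t k := by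
  induction a with
  | zero => exact one_mem _
  | succ a ih => exact mul_mem (stab_antitone t (by omega) (strand_mem_stab t (k + a) b)) ih

theorem strand_mem_fixing (k b : ℕ) : strand t k b ∈ fixing R (Set.Ici (k + b + 1)) := by
  induction b with
  | zero => exact one_mem _
  | succ b ih =>
    exact mul_mem (fixing_mono (Set.Ici_subset_Ici.2 (by omega)) ih)
      (theta_mem_fixing_Ici t (by omega))

theorem braid_mem_fixing (k a b : ℕ) : braid t k a b ∈ fixing R (Set.Ici (k + a + b)) := by
  induction a with
  | zero => exact one_mem _
  | succ a ih =>
    exact mul_mem (fixing_mono (Set.Ici_subset_Ici.2 (by omega)) (strand_mem_fixing t (k + a) b))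
      (fixing_mono (Set.Ici_subset_Ici.2 (by omega)) ih)

theorem commute_of_mem_stab {N : ℕ} {g h : GLInf R} (hg : g ∈ fixing R (Set.Ici N))
    (hh : h ∈ stab t N) : g * h = h * g :=
  commute_of_fixing hg (by rw [Set.compl_Ici]; exact (mem_stab_iff.1 hh).1)

theorem braid_add_left (k a a' b : ℕ) :
    braid t k (a + a') b = braid t (k + a) a' b * braid t k a b := by
  induction a' with
  | zero => exact (one_mul _).symm
  | succ a' ih => rw [← add_assoc, braid_succ, ih, braid_succ, mul_assoc, add_assoc]

theorem strand_add (k b b' : ℕ) :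
    strand t k (b + b') = strand t k b * strand t (k + b) b' := by
  induction b' with
  | zero => exact (mul_one _).symm
  | succ b' ih => rw [← add_assoc, strand_succ, ih, strand_succ, mul_assoc, add_assoc]

/-- In the induction on `a`, the far half `strand t (k + a + b) b'` of the new strand has to pass
`braid t k a b`, which ends before coordinate `k + a + b`. -/
theorem braid_add_right (k a b b' : ℕ) :
    braid t k a (b + b') = braid t k a b * braid t (k + b) a b' := by
  induction a with
  | zero => exact (mul_one _).symm
  | succ a ih =>
    have hc := commute_of_mem_stab t (braid_mem_fixing t k a b)
      (strand_mem_stab t (k + a + b) b')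
    rw [braid_succ, ih, strand_add, braid_succ, braid_succ, mul_assoc, ← mul_assoc (strand _ _ b'),
      ← hc, add_right_comm k b a]
    simp only [mul_assoc]

theorem strand_single (k b c : ℕ) : (strand t k b).1 (Finsupp.single c 1) =
    if c < k then Finsupp.single c 1
    else if c < k + b then
      Finsupp.single k ((1 - (t : R)) * (t : R) ^ (c - k)) + Finsupp.single (c + 1) 1
    else if c = k + b then Finsupp.single k ((t : R) ^ b)
    else Finsupp.single c 1 := by
  induction b generalizing c with
  | zero =>
    change Finsupp.single c 1 = _
    split_ifs with h₁ h₂ h₃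
    · rfl
    · omega
    · simp [h₃]
    · rfl
  | succ b ih =>
    change (strand t k b).1 ((theta t (k + b) 1).1 (Finsupp.single c 1)) = _
    rw [theta_single, thetaCol]
    by_cases h₁ : c < k + b
    · rw [if_pos h₁, ih]
      split_ifs <;> first | rfl | omega
    · by_cases h₂ : c = k + b
      · subst h₂
        rw [if_neg (by omega), if_pos (by omega), if_neg (by omega), if_pos (by omega)]
        simp only [Finset.range_one, Finset.sum_singleton, add_zero, Nat.sub_self, pow_zero,
          mul_one, map_add]
        rw [apply_single, ih, ih, if_neg (by omega), if_neg (by omega), if_pos rfl,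
          if_neg (by omega), if_neg (by omega), if_neg (by omega), Finsupp.smul_single,
          Nat.add_sub_cancel_left, smul_eq_mul]
      · by_cases h₃ : c = k + b + 1
        · subst h₃
          rw [if_neg (by omega), if_neg (by omega), if_pos (by omega), if_neg (by omega),
            if_neg (by omega), if_pos (by omega), Nat.add_sub_cancel, apply_single, ih,
            if_neg (by omega), if_neg (by omega), if_pos rfl, Finsupp.smul_single, smul_eq_mul,
            pow_one, pow_succ']
        · rw [if_neg (by omega), if_neg (by omega), if_neg (by omega), ih]
          split_ifs <;> first | rfl | omega

/-- Each further strand fixes the terms at `k + i` with `i < a` already present, and splits the term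
at `c + a` into a new one at `k + a` and one at `c + a + 1`. -/
theorem braid_single (k a b c : ℕ) : (braid t k a b).1 (Finsupp.single c 1) =
    if c < k then Finsupp.single c 1
    else if c < k + b then
      (∑ i ∈ Finset.range a, Finsupp.single (k + i) ((1 - (t : R)) * (t : R) ^ (c - k))) +
        Finsupp.single (c + a) 1
    else if c < k + b + a then Finsupp.single (c - b) ((t : R) ^ b)
    else Finsupp.single c 1 := by
  induction a with
  | zero =>
    change Finsupp.single c 1 = _
    split_ifs with h₁ h₂ h₃
    · rfl
    · simp
    · omega
    · rfl
  | succ a ih =>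
    change (strand t (k + a) b).1 ((braid t k a b).1 (Finsupp.single c 1)) = _
    rw [ih]
    by_cases h₁ : c < k
    · rw [if_pos h₁, if_pos h₁, strand_single, if_pos (by omega)]
    · by_cases h₂ : c < k + b
      · rw [if_neg h₁, if_pos h₂, if_neg h₁, if_pos h₂, map_add, map_sum, strand_single,
          if_neg (by omega), if_pos (by omega), Finset.sum_range_succ, Nat.add_sub_add_right,
          ← add_assoc]
        congr 2
        refine Finset.sum_congr rfl fun i hi => ?_
        have := Finset.mem_range.1 hi
        rw [apply_single, strand_single, if_pos (by omega), Finsupp.smul_single, smul_eq_mul,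
          mul_one]
      · by_cases h₃ : c < k + b + a
        · rw [if_neg h₁, if_neg h₂, if_pos h₃, if_neg h₁, if_neg h₂, if_pos (by omega),
            apply_single, strand_single, if_pos (by omega), Finsupp.smul_single, smul_eq_mul,
            mul_one]
        · rw [if_neg h₁, if_neg h₂, if_neg h₃, if_neg h₁, if_neg h₂, strand_single,
            if_neg (by omega), if_neg (by omega)]
          by_cases h₄ : c = k + a + b
          · rw [if_pos h₄, if_pos (by omega)]
            congr 1
            omega
          · rw [if_neg h₄, if_neg (by omega)]

theorem braid_self (k j : ℕ) : braid t k j j = theta t k j := by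
  apply Subtype.ext
  apply LinearEquiv.toLinearMap_injective
  refine hom_ext fun c => ?_
  change (braid t k j j).1 _ = (theta t k j).1 _
  rw [braid_single, theta_single, thetaCol, add_assoc k j j, ← two_mul]

theorem theta_mem_stab (k j : ℕ) : theta t k j ∈ stab t k :=
  braid_self t k j ▸ braid_mem_stab t k j j

/-! ### Sliding stabilizer elements through `theta`. -/

theorem eq_sum_of_fixing {k j : ℕ} {z : ℕ →₀ R} (hz : ∀ c, c < k ∨ k + j ≤ c → z c = 0) :
    z = ∑ c ∈ Finset.range j, Finsupp.single (k + c) (z (k + c)) := by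
  ext i
  rw [Finsupp.finsetSum_apply]
  by_cases h : i < k ∨ k + j ≤ i
  · rw [hz i h]
    refine (Finset.sum_eq_zero fun c hc => ?_).symm
    have := Finset.mem_range.1 hc
    rw [Finsupp.single_apply, if_neg (by omega)]
  · obtain ⟨c, rfl⟩ := Nat.exists_eq_add_of_le (show k ≤ i by omega)
    rw [Finset.sum_eq_single c]
    · simp
    · intro d _ hd
      rw [Finsupp.single_apply, if_neg (by omega)]
    · intro hc
      exact absurd (Finset.mem_range.2 (by omega)) hc

/-- For large `j` the action of `h` is confined to the coordinates from `k` to `k + j - 1`. The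
all-ones vector of that block is a difference of two truncations of `u`, both fixed by `h`. -/
theorem exists_fixing_of_mem_stab {k : ℕ} {h : GLInf R} (hh : h ∈ stab t k) :
    ∃ j₀, ∀ j, j₀ ≤ j → h ∈ fixing R {i | i < k ∨ k + j ≤ i} ∧
      h.1 (∑ i ∈ Finset.range j, Finsupp.single (k + i) 1) =
        ∑ i ∈ Finset.range j, Finsupp.single (k + i) 1 := by
  obtain ⟨h₁, h₂⟩ := mem_stab_iff.1 hh
  obtain ⟨N, hN⟩ := exists_mem_fixing h
  obtain ⟨M, hM⟩ := (fixesCol_iff _ _).1 (mem_blockStabilizer_zero.1 h₂).2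
  refine ⟨N + M, fun j hj => ⟨?_, ?_⟩⟩
  · refine ⟨fun c hc => ?_, fun c hc => ?_⟩ <;> rcases hc with hc | hc
    · exact h₁.1 c hc
    · exact hN.1 c (show N ≤ c by omega)
    · exact h₁.2 c hc
    · exact hN.2 c (show N ≤ c by omega)
  · have e : ∑ i ∈ Finset.range j, Finsupp.single (k + i) (1 : R) =
        trunc (fun _ => 1) (k + j) - trunc (fun _ => 1) k := by
      rw [trunc, trunc, Finset.sum_range_add, add_sub_cancel_left]
    have ek : h.1 (trunc (fun _ => 1) k) = trunc (fun _ => 1) k :=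
      apply_eq_self h₁ fun i hi => by rw [trunc_apply, if_neg (by simpa using hi)]
    rw [e, map_sub, hM _ (by omega), ek]

theorem sub_apply_eq_zero {s : Set ℕ} {h : GLInf R} (hh : h ∈ fixing R s) (y : ℕ →₀ R) {c : ℕ}
    (hc : c ∈ s) : (h.1 y - y) c = 0 := by
  rw [Finsupp.sub_apply, hh.2 c hc, sub_self]

/-- For the conjugate `Θ h Θ⁻¹`, the columns below `k + j` are trivial because `Θ⁻¹` moves the block
on which `h` acts away from it. The rows are trivial because `h y - y` is killed by `v`, hence by
`V`. -/
theorem theta_slide_left {k : ℕ} {h : GLInf R} (hh : h ∈ stab t k) :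
    ∃ j₀, ∀ j, j₀ ≤ j → ∃ h' ∈ stab t (k + j), theta t k j * h = h' * theta t k j := by
  obtain ⟨j₀, hj₀⟩ := exists_fixing_of_mem_stab t hh
  refine ⟨j₀, fun j hj => ⟨theta t k j * h * (theta t k j)⁻¹, mem_stab_iff.2 ⟨⟨fun c hc => ?_,
    fun i hi x => ?_⟩, ?_⟩, by group⟩⟩
  · obtain ⟨hF, -⟩ := hj₀ j hj
    have hc : c < k + j := hc
    change (theta t k j).1 (h.1 (((theta t k j)⁻¹).1 _)) = _
    rw [apply_eq_self hF, apply_inv_apply]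
    intro i hi
    simp only [Set.mem_ofPred_eq] at hi
    rw [theta_inv_single, thetaInvCol]
    split_ifs <;> rw [Finsupp.single_apply, if_neg (by omega)]
  · obtain ⟨hF, -⟩ := hj₀ j hj
    have hi : i < k + j := hi
    change (theta t k j).1 (h.1 (((theta t k j)⁻¹).1 x)) i = _
    set y := ((theta t k j)⁻¹).1 x with hy
    have hx : x = (theta t k j).1 y := (apply_inv_apply _ _).symm
    rw [hx, ← sub_eq_zero, ← Finsupp.sub_apply, ← map_sub]
    have hz : Finsupp.linearCombination R (fun i => (t : R) ^ i) (h.1 y - y) = 0 := by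
      rw [map_sub, (fixesRow_iff _ _).1 (mem_blockStabilizer_zero.1 (mem_stab_iff.1 hh).2).1,
        sub_self]
    have e := eq_sum_of_fixing (k := k) (j := j) fun c hc => sub_apply_eq_zero hF y hc
    generalize h.1 y - y = z at hz e
    rw [e, map_sum] at hz
    simp only [Finsupp.linearCombination_single, smul_eq_mul] at hz
    -- The rows of `V` start with exponent `0`, whereas `v` restricted to the block starts with `t ^
    -- k`; the unit is cancelled.
    have hz' : ∑ c ∈ Finset.range j, z (k + c) * (t : R) ^ c = 0 := by
      refine ((t ^ k).isUnit.mul_right_eq_zero).1 ?_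
      rw [← hz, Finset.mul_sum]
      refine Finset.sum_congr rfl fun c _ => ?_
      push_cast
      ring
    rw [e, map_sum, Finsupp.finsetSum_apply]
    by_cases hk : k ≤ i
    · calc _ = ∑ c ∈ Finset.range j, (1 - (t : R)) * (z (k + c) * (t : R) ^ c) := by
            refine Finset.sum_congr rfl fun c hc => ?_
            have := Finset.mem_range.1 hc
            have he := theta_entry t k j i (k + c)
            rw [if_pos (by omega), Nat.add_sub_cancel_left] at he
            rw [apply_single, Finsupp.smul_apply, smul_eq_mul]
            change z (k + c) * entry (theta t k j) i (k + c) = _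
            rw [he]
            ring
        _ = 0 := by rw [← Finset.mul_sum, hz', mul_zero]
    · refine Finset.sum_eq_zero fun c hc => ?_
      rw [(theta_mem_fixing_Iio t k j).2 i (show i < k by omega), Finsupp.single_apply,
        if_neg (by omega)]
  · exact mul_mem (mul_mem (stab_antitone t (Nat.zero_le k) (theta_mem_stab t k j))
      (stab_antitone t (Nat.zero_le k) hh))
      (inv_mem (stab_antitone t (Nat.zero_le k) (theta_mem_stab t k j)))

/-- For `Θ⁻¹ h Θ` the roles are exchanged: the columns of `V` are multiples of the all-ones vector,
which `h` fixes, while `Θ⁻¹` sends the block containing `h y - y` to coordinates from `k + j` on. -/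
theorem theta_slide_right {k : ℕ} {h : GLInf R} (hh : h ∈ stab t k) :
    ∃ j₀, ∀ j, j₀ ≤ j → ∃ h' ∈ stab t (k + j), h * theta t k j = theta t k j * h' := by
  obtain ⟨j₀, hj₀⟩ := exists_fixing_of_mem_stab t hh
  refine ⟨j₀, fun j hj => ⟨(theta t k j)⁻¹ * h * theta t k j, mem_stab_iff.2 ⟨⟨fun c hc => ?_,
    fun i hi x => ?_⟩, ?_⟩, by group⟩⟩
  · obtain ⟨hF, hw⟩ := hj₀ j hj
    have hc : c < k + j := hc
    change ((theta t k j)⁻¹).1 (h.1 ((theta t k j).1 _)) = _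
    have e : h.1 (thetaCol t k j c) = thetaCol t k j c := by
      unfold thetaCol
      split_ifs with h₁
      · exact hF.1 c (Or.inl h₁)
      · have es : ∑ i ∈ Finset.range j,
            Finsupp.single (k + i) ((1 - (t : R)) * (t : R) ^ (c - k)) =
            ((1 - (t : R)) * (t : R) ^ (c - k)) •
              ∑ i ∈ Finset.range j, Finsupp.single (k + i) (1 : R) := by
          rw [Finset.smul_sum]
          simp
        rw [es, map_add, map_smul, hw, hF.1 (c + j) (Or.inr (by omega))]
    rw [theta_single, e, ← theta_single, inv_apply_apply]
  · obtain ⟨hF, -⟩ := hj₀ j hj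
    have hi : i < k + j := hi
    change ((theta t k j)⁻¹).1 (h.1 ((theta t k j).1 x)) i = _
    set y := (theta t k j).1 x with hy
    have hx : x = ((theta t k j)⁻¹).1 y := (inv_apply_apply _ _).symm
    rw [hx, ← sub_eq_zero, ← Finsupp.sub_apply, ← map_sub,
      eq_sum_of_fixing (k := k) (j := j) fun c hc => sub_apply_eq_zero hF y hc,
      map_sum, Finsupp.finsetSum_apply]
    refine Finset.sum_eq_zero fun c hc => ?_
    have := Finset.mem_range.1 hc
    rw [apply_single, theta_inv_single, thetaInvCol, if_neg (by omega), if_pos (by omega),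
      Finsupp.smul_single, Finsupp.single_apply, if_neg (by omega)]
  · exact mul_mem (mul_mem (inv_mem (stab_antitone t (Nat.zero_le k) (theta_mem_stab t k j)))
      (stab_antitone t (Nat.zero_le k) hh)) (stab_antitone t (Nat.zero_le k) (theta_mem_stab t k j))

theorem isBraiding : IsBraiding (stab t) (fun N => fixing R (Set.Ici N)) (braid t) where
  antitone := stab_antitone t
  monotone := fun _ _ h => fixing_mono (Set.Ici_subset_Ici.2 h)
  exists_mem := exists_mem_fixing
  commute := commute_of_mem_stab t
  mem := braid_mem_stab t
  add_left := braid_add_left t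
  add_right := braid_add_right t
  slide_left := fun hh => by simpa only [braid_self] using theta_slide_left t hh
  slide_right := fun hh => by simpa only [braid_self] using theta_slide_right t hh

theorem exists_isStableProduct_isAssocOp : ∃ μ : DoubleCosetOp (stab t),
    IsStableProduct (stab t) (theta t) μ ∧ IsAssocOp (stab t) μ := by
  obtain ⟨μ, hμ⟩ := (isBraiding t).exists_isStableProduct
  refine ⟨μ, ?_, (isBraiding t).isAssocOp hμ⟩
  simpa only [braid_self] using hμ

end Braids

/-! ### Change of the base ring. -/

section ChangeOfRing

variable {R S : Type*} [CommRing R] [CommRing S] (f : R →+* S)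

theorem finite_support_entry_col (X : GLInf R) (j : ℕ) :
    (Function.support fun i => entry X i j).Finite :=
  Finsupp.hasFiniteSupport (X.1 (Finsupp.single j 1))

theorem finite_support_entry_row (X : GLInf R) (i : ℕ) :
    (Function.support fun j => entry X i j).Finite := by
  obtain ⟨N, hN⟩ := exists_mem_fixing X
  refine (Set.finite_Iio (N + i + 1)).subset fun j hj => ?_
  by_contra h
  simp only [Set.mem_Iio, not_lt] at h
  refine hj ?_
  change entry X i j = 0
  rw [mem_fixing_iff_entry.1 hN i j (Or.inr (show N ≤ j by omega)), if_neg (by omega)]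

theorem FixesRow.map {v : ℕ → R} {X : GLInf R} (h : FixesRow v X) :
    FixesRow (fun i => f (v i)) (GLInf.map f X) := by
  intro j
  change _ = f (v j)
  rw [← h j]
  -- A `finsum` with infinite support is `0` by convention, so commuting it with `f` requires the
  -- finiteness of the columns.
  refine Eq.trans ?_ (f.toAddMonoidHom.map_finsum
    ((finite_support_entry_col X j).subset (Function.support_mul_subset_right _ _))).symm
  refine finsum_congr fun i => ?_
  rw [map_entry]
  exact (map_mul f _ _).symm

theorem FixesCol.map {u : ℕ → R} {X : GLInf R} (h : FixesCol u X) :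
    FixesCol (fun i => f (u i)) (GLInf.map f X) := by
  intro i
  change _ = f (u i)
  rw [← h i]
  refine Eq.trans ?_ (f.toAddMonoidHom.map_finsum
    ((finite_support_entry_row X i).subset (Function.support_mul_subset_left _ _))).symm
  refine finsum_congr fun j => ?_
  rw [map_entry]
  exact (map_mul f _ _).symm

theorem IsBlock.map {n : ℕ} {g X : GLInf R} (h : IsBlock n g X) :
    IsBlock n (GLInf.map f g) (GLInf.map f X) := by
  intro i j
  rw [map_entry, map_entry, h i j]
  split_ifs <;> simp

theorem map_blockStabilizer_le (v u : ℕ → R) (n : ℕ) :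
    (blockStabilizer v u n).map (GLInf.map f) ≤
      blockStabilizer (fun i => f (v i)) (fun i => f (u i)) n := by
  rintro _ ⟨g, ⟨X, hX, hX', h⟩, rfl⟩
  exact ⟨GLInf.map f X, hX.map f, hX'.map f, h.map f⟩

theorem swap_entry (k j a b : ℕ) :
    entry (swap R k j) a b = if swapFun k j b = a then 1 else 0 := by
  have : (swap R k j).1 (Finsupp.single b 1) = Finsupp.single (swapFun k j b) 1 :=
    Finsupp.domLCongr_single _ _ _
  rw [entry, autEntry, this, Finsupp.single_apply]

theorem map_theta_eq_swap {t : Rˣ} (ht : f t = 1) (k j : ℕ) :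
    GLInf.map f (theta t k j) = swap S k j := by
  refine ext_entry fun a b => ?_
  rw [map_entry, theta_entry, swap_entry, swapFun]
  split_ifs <;> first | omega | simp [ht]

theorem theta_one_eq_swap (k j : ℕ) : theta (1 : Rˣ) k j = swap R k j := by
  rw [← map_theta_eq_swap (RingHom.id R) (t := 1) (by simp)]
  exact ext_entry fun a b => by simp [map_entry]

end ChangeOfRing

end GLInf

/-! ### Specialization at `t = 1` and the theorem. -/

theorem eval_one_tUnit :
    LaurentPolynomial.eval₂ (RingHom.id ℤ) 1 (tUnit : ℤ[T;T⁻¹]) = 1 := by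
  change LaurentPolynomial.eval₂ (RingHom.id ℤ) 1 (LaurentPolynomial.T 1) = 1
  rw [LaurentPolynomial.eval₂_T]
  simp

theorem stab_one_eq : GLInf.stab (1 : ℤˣ) = G₁ := by
  funext n
  simp [GLInf.stab, G₁]

theorem atOne_theta (k j : ℕ) : atOne (GLInf.theta tUnit k j) = GLInf.swap ℤ k j :=
  GLInf.map_theta_eq_swap _ eval_one_tUnit k j

theorem map_atOne_G_le (n : ℕ) : (G n).map atOne ≤ G₁ n := by
  refine (GLInf.map_blockStabilizer_le _ _ _ n).trans_eq ?_
  simp only [map_pow, eval_one_tUnit, one_pow, map_one, G₁]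

theorem mk_atOne_eq {n m : ℕ} {g h : GLInf ℤ[T;T⁻¹]}
    (e : DoubleCoset.mk (G n) (G m) g = DoubleCoset.mk (G n) (G m) h) :
    DoubleCoset.mk (G₁ n) (G₁ m) (atOne g) = DoubleCoset.mk (G₁ n) (G₁ m) (atOne h) := by
  obtain ⟨x, hx, y, hy, rfl⟩ := (DoubleCoset.eq _ _ _ _).1 e
  exact (DoubleCoset.eq _ _ _ _).2 ⟨atOne x, map_atOne_G_le n ⟨x, hx, rfl⟩, atOne y,
    map_atOne_G_le m ⟨y, hy, rfl⟩, by simp only [map_mul]⟩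

/-- The products `G[n] p Θ_j[k] q G[m]` stabilize for large `j`, the stable value depends only on
the double cosets of `p` and `q`, and the resulting operation is associative. Setting `t = 1` turns
it into the usual product, defined in the same way by permutation matrices. -/
theorem theorem1p9 :
    ∃ star : DoubleCosetOp G,
      IsStableProduct G (GLInf.theta tUnit) star ∧
      IsAssocOp G star ∧
      ∃ usual : DoubleCosetOp G₁,
        IsStableProduct G₁ (GLInf.swap ℤ) usual ∧
        IsAssocOp G₁ usual ∧
        (∀ n, (G n).map atOne ≤ G₁ n) ∧
        (∀ k j, atOne (GLInf.theta tUnit k j) = GLInf.swap ℤ k j) ∧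
        ∀ (n k m : ℕ) (p q r : GLInf ℤ[T;T⁻¹]),
          star n k m (DoubleCoset.mk (G n) (G k) p) (DoubleCoset.mk (G k) (G m) q) =
              DoubleCoset.mk (G n) (G m) r →
            usual n k m (DoubleCoset.mk (G₁ n) (G₁ k) (atOne p))
                (DoubleCoset.mk (G₁ k) (G₁ m) (atOne q)) =
              DoubleCoset.mk (G₁ n) (G₁ m) (atOne r) := by
  obtain ⟨star, hs, hs'⟩ := GLInf.exists_isStableProduct_isAssocOp tUnit
  have hu : ∃ usual : DoubleCosetOp G₁,
      IsStableProduct G₁ (GLInf.swap ℤ) usual ∧ IsAssocOp G₁ usual := by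
    have h := GLInf.exists_isStableProduct_isAssocOp (1 : ℤˣ)
    rw [stab_one_eq, show GLInf.theta (1 : ℤˣ) = GLInf.swap ℤ from
      funext fun k => funext fun j => GLInf.theta_one_eq_swap k j] at h
    exact h
  obtain ⟨usual, hu, hu'⟩ := hu
  refine ⟨star, hs, hs', usual, hu, hu', map_atOne_G_le, atOne_theta, fun n k m p q r h => ?_⟩
  obtain ⟨i, hi⟩ := hs n k m p q
  obtain ⟨j, hj⟩ := hu n k m (atOne p) (atOne q)
  -- The index `i + j` lies in the stable range of both products, so one representative computes
  -- both of them.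
  rw [← hj (i + j) (by omega), ← atOne_theta, ← map_mul, ← map_mul]
  exact mk_atOne_eq ((hi (i + j) (by omega)).trans h)
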